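/- Let $G$ be a finite simple graph with at least $4$ edges. If $G$ has diameter $2$ and contains no triangle, then $G$ is edge-reconstructible; that is, $G$ is isomorphic to every finite simple graph $H$ that has the same edge-deck as $G$, where the edge-deck of a graph $G$ is the multiset $\{G-e : e\in E(G)\}$ of its edge-deleted spanning subgraphs, considered up to isomorphism. -/

import Mathlib

/-- `G` and `H` have the same edge-deck. The edge-deck of `G` is the multiset of the isomorphism
types of its edge-cards `G - e` (delete the edge `e`, keep all vertices), one for each edge `e`
of `G`. Two such multisets are equal exactly when the edges of `G` and of `H` can be matched
bijectively so that corresponding edge-cards are isomorphic. -/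
def SimpleGraph.SameEdgeDeck {V W : Type*} (G : SimpleGraph V) (H : SimpleGraph W) : Prop :=
  ∃ σ : G.edgeSet ≃ H.edgeSet, ∀ e : G.edgeSet,
    Nonempty (G.deleteEdges {(e : Sym2 V)} ≃g H.deleteEdges {(σ e : Sym2 W)})

/-- `G` is edge-reconstructible: it is isomorphic to every finite simple graph `H`, on whatever
vertex set, that has the same edge-deck. -/
def SimpleGraph.EdgeReconstructible.{u, v} {V : Type u} (G : SimpleGraph V) : Prop :=
  ∀ (W : Type v) [Finite W] (H : SimpleGraph W), G.SameEdgeDeck H → Nonempty (G ≃g H)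

universe u v

/-! A triangle-free graph is two-step connected exactly when its pairs of distinct vertices without
a common neighbour are its edges. Counting pairs with `t` chosen common neighbours (`K_{2,t}`, with
`2t` edges) is edge-reconstructible for `2t < m`, where `m` is the number of edges, and the
alternating sum over `t` counts the pairs with none. So `H` is two-step connected too, unless the
common neighbours of one pair use all `m` edges; then a single card forces the graph
(`exists_edge_forall_eq`). If `H` were not isomorphic to `G`, every edge `uv` of `G` would slide to
some `uw` with `v` adjacent to `w` (`exists_slide`). Equality of the sums of squared degrees then
makes adjacent degrees differ by exactly one, which leaves at most three vertices
(`not_forall_slides`). -/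

namespace SimpleGraph

variable {V : Type u} {W : Type v}

/-! ### Diameter two and triangle-freeness as local conditions -/

/-- Distinct non-adjacent vertices have a common neighbour. -/
def TwoStepConnected (G : SimpleGraph V) : Prop :=
  ∀ ⦃x y⦄, x ≠ y → ¬ G.Adj x y → ∃ z, G.Adj x z ∧ G.Adj y z

/-- No two adjacent vertices have a common neighbour. -/
def NoTriangle (G : SimpleGraph V) : Prop :=
  ∀ ⦃x y z⦄, G.Adj x y → G.Adj x z → G.Adj y z → False

theorem CliqueFree.noTriangle {G : SimpleGraph V} (h : G.CliqueFree 3) : G.NoTriangle := by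
  classical
  intro x y z hxy hxz hyz
  exact h {x, y, z} (is3Clique_triple_iff.2 ⟨hxy, hxz, hyz⟩)

theorem twoStepConnected_of_diam {G : SimpleGraph V} (h : G.diam = 2) : G.TwoStepConnected := by
  intro x y hne hadj
  have htop : G.ediam ≠ ⊤ := by
    intro h'
    -- `diam` takes the value `0` when `ediam = ⊤`.
    simp [diam, h'] at h
  have : Nonempty V := ⟨x⟩
  have hconn : G.Connected := by
    exact connected_of_ediam_ne_top htop
  obtain ⟨p, hp⟩ := hconn.exists_walk_length_eq_dist x y
  have hle : p.length ≤ 2 := hp ▸ h ▸ dist_le_diam htop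
  cases p with
  | nil => exact (hne rfl).elim
  | cons h1 q =>
    cases q with
    | nil => exact (hadj h1).elim
    | cons h2 r =>
      cases r with
      | nil => exact ⟨_, h1, h2.symm⟩
      | cons h3 s => simp at hle

theorem Iso.twoStepConnected {G : SimpleGraph V} {H : SimpleGraph W} (φ : G ≃g H)
    (h : G.TwoStepConnected) : H.TwoStepConnected := by
  intro x y hne hadj
  obtain ⟨z, h1, h2⟩ := h (φ.symm.injective.ne hne) (fun h' => hadj (φ.symm.map_adj_iff.1 h'))
  exact ⟨φ z, by simpa using φ.map_adj_iff.2 h1, by simpa using φ.map_adj_iff.2 h2⟩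

theorem Iso.noTriangle {G : SimpleGraph V} {H : SimpleGraph W} (φ : G ≃g H)
    (h : G.NoTriangle) : H.NoTriangle := fun _ _ _ h1 h2 h3 =>
  h (φ.symm.map_adj_iff.2 h1) (φ.symm.map_adj_iff.2 h2) (φ.symm.map_adj_iff.2 h3)

theorem Iso.ncard_commonNeighbors {G : SimpleGraph V} {H : SimpleGraph W} (φ : G ≃g H) (x y : V) :
    (H.commonNeighbors (φ x) (φ y)).ncard = (G.commonNeighbors x y).ncard := by
  rw [← Set.ncard_image_of_injective (G.commonNeighbors x y) φ.injective]
  congr 1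
  ext z
  simp only [Set.mem_image, mem_commonNeighbors]
  constructor
  · rintro ⟨h1, h2⟩
    refine ⟨φ.symm z, ⟨?_, ?_⟩, by simp⟩
    · rw [← φ.map_adj_iff]; simpa using h1
    · rw [← φ.map_adj_iff]; simpa using h2
  · rintro ⟨w, ⟨h1, h2⟩, rfl⟩
    exact ⟨φ.map_adj_iff.2 h1, φ.map_adj_iff.2 h2⟩

/-! ### Edge-decks -/

theorem SameEdgeDeck.symm {G : SimpleGraph V} {H : SimpleGraph W} (h : G.SameEdgeDeck H) :
    H.SameEdgeDeck G := by
  obtain ⟨σ, hσ⟩ := h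
  refine ⟨σ.symm, fun e => ?_⟩
  obtain ⟨φ⟩ := hσ (σ.symm e)
  rw [σ.apply_symm_apply] at φ
  exact ⟨φ.symm⟩

theorem SameEdgeDeck.ncard_edgeSet {G : SimpleGraph V} {H : SimpleGraph W}
    (h : G.SameEdgeDeck H) : G.edgeSet.ncard = H.edgeSet.ncard := by
  obtain ⟨σ, -⟩ := h
  exact Nat.card_congr σ

/-- A triangle has three edges, so it survives in the card of a fourth. -/
theorem SameEdgeDeck.noTriangle {G : SimpleGraph V} {H : SimpleGraph W}
    (h : G.SameEdgeDeck H) (hE : 4 ≤ G.edgeSet.ncard) (hG : G.NoTriangle) : H.NoTriangle := by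
  classical
  intro x y z hxy hxz hyz
  have hlt : (({s(x, y), s(x, z), s(y, z)} : Finset (Sym2 W)) : Set (Sym2 W)).ncard
      < H.edgeSet.ncard := by
    rw [Set.ncard_coe_finset, ← h.ncard_edgeSet]
    exact lt_of_le_of_lt Finset.card_le_three hE
  obtain ⟨e, he, hne⟩ := Set.exists_mem_notMem_of_ncard_lt_ncard hlt
  obtain ⟨σ, hσ⟩ := h.symm
  obtain ⟨φ⟩ := hσ ⟨e, he⟩
  simp only [Finset.coe_insert, Finset.coe_singleton, Set.mem_insert_iff, Set.mem_singleton_iff,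
    not_or] at hne
  have key : ∀ a b, H.Adj a b → s(a, b) ≠ e → G.Adj (φ a) (φ b) := fun a b hab hn =>
    deleteEdges_le _ (φ.map_adj_iff.2 (by simpa [deleteEdges_adj] using ⟨hab, hn⟩))
  exact hG (key _ _ hxy (Ne.symm hne.1)) (key _ _ hxz (Ne.symm hne.2.1))
    (key _ _ hyz (Ne.symm hne.2.2))

/-- A graph with the same edge-deck is, up to isomorphism, obtained by replacing any given edge. -/
theorem SameEdgeDeck.exists_replace {G : SimpleGraph V} {H : SimpleGraph W}
    (h : G.SameEdgeDeck H) {e : Sym2 V} (he : e ∈ G.edgeSet) :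
    ∃ H' : SimpleGraph V, Nonempty (H' ≃g H) ∧
      ∃ f ∈ H'.edgeSet, G.deleteEdges {e} = H'.deleteEdges {f} := by
  obtain ⟨σ, hσ⟩ := h
  obtain ⟨φ⟩ := hσ ⟨e, he⟩
  obtain ⟨⟨f, hf⟩, hf'⟩ : ∃ f, f = σ ⟨e, he⟩ := ⟨_, rfl⟩
  rw [← hf'] at φ
  refine ⟨H.comap φ, ⟨Iso.comap φ.toEquiv H⟩, ?_⟩
  induction f with
  | _ a b =>
    refine ⟨s(φ.symm a, φ.symm b), by simpa using hf, ?_⟩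
    ext x y
    rw [← φ.map_adj_iff]
    simp only [deleteEdges_adj, comap_adj, Set.mem_singleton_iff, Sym2.eq_iff]
    have hinv : ∀ p q, p = φ.symm q ↔ φ p = q := fun p q => φ.toEquiv.eq_symm_apply
    simp only [hinv]

/-! ### Kelly-type counting of common neighbours -/

open Finset in
theorem card_image_union_image [DecidableEq V] {x y : V} {S : Finset V} (hxy : x ≠ y)
    (hy : y ∉ S) :
    (S.image (fun z => s(x, z)) ∪ S.image (fun z => s(y, z))).card = 2 * S.card := by
  rw [card_union_of_disjoint, card_image_of_injective, card_image_of_injective, two_mul]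
  · intro a b h; grind
  · intro a b h; grind
  · rw [Finset.disjoint_left]
    simp only [mem_image, not_exists, not_and]
    rintro _ ⟨a, ha, rfl⟩ b hb h
    rw [Sym2.eq_iff] at h
    rcases h with ⟨h, -⟩ | ⟨h, -⟩
    · exact hxy h.symm
    · exact hy (h ▸ ha)

open Finset in
/-- Kelly's lemma for the number of `t`-sets of common neighbours of two given vertices. -/
theorem sum_choose_commonNeighbors_deleteEdges [Finite V] (G : SimpleGraph V)
    [Fintype G.edgeSet] {x y : V} (hxy : x ≠ y) (t : ℕ) :
    ∑ e : G.edgeSet, ((G.deleteEdges {(e : Sym2 V)}).commonNeighbors x y).ncard.choose t =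
      (G.edgeSet.ncard - 2 * t) * (G.commonNeighbors x y).ncard.choose t := by
  classical
  have := Fintype.ofFinite V
  set C := (G.commonNeighbors x y).toFinset with hC
  -- `T S` is the edge set of the `K_{2,t}` between `{x, y}` and `S`; a card keeps it iff the
  -- deleted edge lies outside.
  let T : Finset V → Finset (Sym2 V) := fun S =>
    S.image (fun z => s(x, z)) ∪ S.image (fun z => s(y, z))
  have hmem : ∀ z, z ∈ C ↔ G.Adj x z ∧ G.Adj y z := fun z => by
    simp [hC, mem_commonNeighbors]
  have h1 : ∀ e : G.edgeSet,
      ((G.deleteEdges {(e : Sym2 V)}).commonNeighbors x y).ncard.choose t =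
        #{S ∈ C.powersetCard t | (e : Sym2 V) ∉ T S} := by
    intro e
    rw [Set.ncard_eq_toFinset_card', ← card_powersetCard]
    congr 1
    ext S
    simp only [mem_powersetCard, mem_filter, subset_iff, Set.mem_toFinset, mem_commonNeighbors,
      deleteEdges_adj, Set.mem_singleton_iff, hmem, T, mem_union, mem_image, not_or, not_exists,
      not_and]
    grind
  have h2 : ∀ S ∈ C.powersetCard t,
      #{e : G.edgeSet | (e : Sym2 V) ∉ T S} = G.edgeSet.ncard - 2 * t := by
    intro S hS
    rw [mem_powersetCard] at hS
    have hcard : (T S).card = 2 * t := by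
      rw [← hS.2]
      refine card_image_union_image hxy (fun h => ?_)
      exact G.loopless.irrefl _ ((hmem _).1 (hS.1 h)).2
    have hsub : T S ⊆ G.edgeFinset := by
      intro e he
      simp only [T, mem_union, mem_image] at he
      rw [mem_edgeFinset]
      rcases he with ⟨z, hz, rfl⟩ | ⟨z, hz, rfl⟩
      · exact ((hmem _).1 (hS.1 hz)).1
      · exact ((hmem _).1 (hS.1 hz)).2
    rw [← hcard, Set.ncard_eq_toFinset_card', ← edgeFinset, ← card_sdiff_of_subset hsub]
    refine card_bij (fun e _ => e.1) ?_ ?_ ?_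
    · intro e he
      simpa using he
    · intro a _ b _ h
      exact Subtype.ext h
    · intro b hb
      simp only [mem_sdiff, mem_edgeFinset] at hb
      exact ⟨⟨b, hb.1⟩, by simpa using hb.2, rfl⟩
  calc _ = ∑ e : G.edgeSet, #{S ∈ C.powersetCard t | (e : Sym2 V) ∉ T S} :=
        sum_congr rfl fun e _ => h1 e
    _ = ∑ S ∈ C.powersetCard t, #{e : G.edgeSet | (e : Sym2 V) ∉ T S} :=
        sum_card_bipartiteAbove_eq_sum_card_bipartiteBelow _
    _ = ∑ S ∈ C.powersetCard t, (G.edgeSet.ncard - 2 * t) := sum_congr rfl h2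
    _ = _ := by
      rw [sum_const, card_powersetCard, hC, ← Set.ncard_eq_toFinset_card', smul_eq_mul, mul_comm]

open scoped Classical in
/-- The number of ways to choose an ordered pair of distinct vertices together with `t` of their
common neighbours. -/
noncomputable def codegreeSum [Fintype V] (G : SimpleGraph V) (t : ℕ) : ℕ :=
  ∑ p ∈ (Finset.univ : Finset V).offDiag, (G.commonNeighbors p.1 p.2).ncard.choose t

theorem Iso.codegreeSum_eq [Fintype V] [Fintype W] {G : SimpleGraph V} {H : SimpleGraph W}
    (φ : G ≃g H) (t : ℕ) : G.codegreeSum t = H.codegreeSum t := by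
  classical
  refine Finset.sum_equiv (φ.toEquiv.prodCongr φ.toEquiv) ?_ ?_
  · simp
  · rintro ⟨x, y⟩ -
    exact congrArg (fun n => Nat.choose n t) (φ.ncard_commonNeighbors x y).symm

theorem sum_codegreeSum_deleteEdges [Fintype V] (G : SimpleGraph V) [Fintype G.edgeSet] (t : ℕ) :
    ∑ e : G.edgeSet, (G.deleteEdges {(e : Sym2 V)}).codegreeSum t =
      (G.edgeSet.ncard - 2 * t) * G.codegreeSum t := by
  classical
  unfold codegreeSum
  rw [Finset.sum_comm, Finset.mul_sum]
  refine Finset.sum_congr rfl fun p hp => ?_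
  convert G.sum_choose_commonNeighbors_deleteEdges (Finset.mem_offDiag.1 hp).2.2 t

/-- The bound on `t` makes the factor `m - 2 * t` positive, hence cancellable. -/
theorem SameEdgeDeck.codegreeSum_eq [Fintype V] [Fintype W] {G : SimpleGraph V}
    {H : SimpleGraph W} (h : G.SameEdgeDeck H) {t : ℕ} (ht : 2 * t < G.edgeSet.ncard) :
    G.codegreeSum t = H.codegreeSum t := by
  classical
  have hm := h.ncard_edgeSet
  obtain ⟨σ, hσ⟩ := h
  have key := G.sum_codegreeSum_deleteEdges t
  rw [Finset.sum_congr rfl fun e _ => (hσ e).some.codegreeSum_eq t,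
    σ.sum_comp fun f : H.edgeSet => (H.deleteEdges {(f : Sym2 W)}).codegreeSum t,
    H.sum_codegreeSum_deleteEdges t, ← hm] at key
  exact (Nat.eq_of_mul_eq_mul_left (by omega) key).symm

/-! ### Codegree bounds, squared degrees, pairs without common neighbours -/

theorem two_mul_ncard_commonNeighbors_le [Finite V] (G : SimpleGraph V) {x y : V} (hxy : x ≠ y) :
    2 * (G.commonNeighbors x y).ncard ≤ G.edgeSet.ncard := by
  classical
  have := Fintype.ofFinite V
  rw [Set.ncard_eq_toFinset_card', Set.ncard_eq_toFinset_card',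
    ← card_image_union_image hxy (by simp [mem_commonNeighbors])]
  refine Finset.card_le_card fun e he => ?_
  simp only [Finset.mem_union, Finset.mem_image, Set.mem_toFinset, mem_commonNeighbors] at he ⊢
  rcases he with ⟨z, hz, rfl⟩ | ⟨z, hz, rfl⟩
  · exact hz.1
  · exact hz.2

/-- If `x` and `y` have so many common neighbours that these account for all edges, then every
edge joins `x` or `y` to one of them. -/
theorem exists_commonNeighbor_of_mem_edgeSet [Finite V] {G : SimpleGraph V} {x y : V}
    (hxy : x ≠ y) (hm : 2 * (G.commonNeighbors x y).ncard = G.edgeSet.ncard) {a b : V}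
    (hab : G.Adj a b) : ∃ z, G.Adj x z ∧ G.Adj y z ∧ (s(a, b) = s(x, z) ∨ s(a, b) = s(y, z)) := by
  classical
  have := Fintype.ofFinite V
  rw [Set.ncard_eq_toFinset_card', Set.ncard_eq_toFinset_card',
    ← card_image_union_image hxy (by simp [mem_commonNeighbors])]
    at hm
  have hsub : ((G.commonNeighbors x y).toFinset.image (fun z => s(x, z)) ∪
      (G.commonNeighbors x y).toFinset.image (fun z => s(y, z))) ⊆ G.edgeSet.toFinset := by
    intro e he
    simp only [Finset.mem_union, Finset.mem_image, Set.mem_toFinset, mem_commonNeighbors] at he ⊢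
    rcases he with ⟨z, hz, rfl⟩ | ⟨z, hz, rfl⟩
    · exact hz.1
    · exact hz.2
  have heq := Finset.eq_of_subset_of_card_le hsub hm.ge
  have hmem : s(a, b) ∈ G.edgeSet.toFinset := by simpa using hab
  rw [← heq] at hmem
  simp only [Finset.mem_union, Finset.mem_image, Set.mem_toFinset, mem_commonNeighbors] at hmem
  grind

/-- Both sides count walks `x z y` of length two; those with `x = y` give twice the edges. -/
theorem sum_sq_ncard_neighborSet [Fintype V] (G : SimpleGraph V) :
    ∑ z, (G.neighborSet z).ncard ^ 2 = G.codegreeSum 1 + 2 * G.edgeSet.ncard := by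
  classical
  have hdeg : ∀ z, (G.neighborSet z).ncard = G.degree z := fun z => by
    rw [Set.ncard_eq_toFinset_card', ← card_neighborFinset_eq_degree]; rfl
  have hE : G.edgeSet.ncard = G.edgeFinset.card := by
    rw [Set.ncard_eq_toFinset_card']; rfl
  have hco : ∀ x y, (G.commonNeighbors x y).ncard =
      ∑ z, (if G.Adj x z then 1 else 0) * (if G.Adj y z then 1 else 0) := by
    intro x y
    rw [Set.ncard_eq_toFinset_card']
    simp only [mul_ite, mul_one, mul_zero, ← ite_and]
    rw [← Finset.card_filter]
    congr 1
    ext z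
    simp [mem_commonNeighbors, and_comm]
  have hd : ∀ z, G.degree z = ∑ x, if G.Adj x z then 1 else 0 := by
    intro z
    rw [← Finset.card_filter, ← card_neighborFinset_eq_degree]
    congr 1
    ext x
    simp [adj_comm]
  have hsplit := Finset.sum_union (f := fun p : V × V => (G.commonNeighbors p.1 p.2).ncard)
    (Finset.disjoint_diag_offDiag (Finset.univ : Finset V))
  rw [Finset.diag_union_offDiag, Finset.sum_diag, Finset.sum_product] at hsplit
  have hdiag : ∑ x, (G.commonNeighbors x x).ncard = 2 * G.edgeSet.ncard := by
    rw [hE, ← sum_degrees_eq_twice_card_edges]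
    refine Finset.sum_congr rfl fun x _ => ?_
    rw [← hdeg, commonNeighbors_eq, Set.inter_self]
  have hoff : G.codegreeSum 1 = ∑ p ∈ (Finset.univ : Finset V).offDiag,
      (G.commonNeighbors p.1 p.2).ncard := by
    simp [codegreeSum]
  rw [hoff, ← hdiag, add_comm, ← hsplit]
  simp only [hco, hdeg]
  rw [Finset.sum_congr rfl fun x _ => Finset.sum_comm, Finset.sum_comm]
  refine Finset.sum_congr rfl fun z _ => ?_
  rw [sq, hd, Finset.sum_mul_sum]

-- The alternating sum of the binomials of `c` is `1` if `c = 0` and `0` otherwise; `hN` makes the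
-- range reach every codegree.
open scoped Classical in
theorem alternating_sum_codegreeSum [Fintype V] (G : SimpleGraph V) {N : ℕ}
    (hN : G.edgeSet.ncard ≤ 2 * N) :
    ∑ t ∈ Finset.range (N + 1), (-1 : ℤ) ^ t * (G.codegreeSum t : ℤ) =
      ((Finset.univ : Finset V).offDiag.filter
        fun p => (G.commonNeighbors p.1 p.2).ncard = 0).card := by
  simp only [codegreeSum, Nat.cast_sum, Finset.mul_sum]
  rw [Finset.sum_comm, Finset.card_filter, Nat.cast_sum]
  refine Finset.sum_congr rfl fun p hp => ?_
  have hle := G.two_mul_ncard_commonNeighbors_le (Finset.mem_offDiag.1 hp).2.2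
  rw [← Finset.sum_subset
    (Finset.range_subset_range.2 (by omega : (G.commonNeighbors p.1 p.2).ncard + 1 ≤ N + 1)),
    Int.alternating_sum_range_choose]
  · simp
  · intro t _ ht
    rw [Nat.choose_eq_zero_of_lt (by simpa using ht)]
    simp

open scoped Classical in
theorem card_filter_adj [Fintype V] (G : SimpleGraph V) :
    ((Finset.univ : Finset (V × V)).filter fun p => G.Adj p.1 p.2).card =
      2 * G.edgeSet.ncard := by
  have hE : G.edgeSet.ncard = G.edgeFinset.card := by
    rw [Set.ncard_eq_toFinset_card']; rfl
  rw [hE, ← sum_degrees_eq_twice_card_edges, Finset.card_filter, ← Finset.univ_product_univ,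
    Finset.sum_product]
  refine Finset.sum_congr rfl fun x _ => ?_
  rw [← Finset.card_filter, ← card_neighborFinset_eq_degree]
  congr 1
  ext y
  simp

theorem ncard_commonNeighbors_eq_zero [Finite V] (G : SimpleGraph V) (x y : V) :
    (G.commonNeighbors x y).ncard = 0 ↔ ∀ z, ¬ (G.Adj x z ∧ G.Adj y z) := by
  rw [Set.ncard_eq_zero (Set.toFinite _), Set.eq_empty_iff_forall_notMem]
  rfl

theorem codegreeSum_eq_zero [Fintype V] {G : SimpleGraph V} {t : ℕ}
    (h : ∀ x y, x ≠ y → (G.commonNeighbors x y).ncard < t) : G.codegreeSum t = 0 := by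
  classical
  exact Finset.sum_eq_zero fun p hp =>
    Nat.choose_eq_zero_of_lt (h _ _ (Finset.mem_offDiag.1 hp).2.2)

/-- For triangle-free graphs, being two-step connected depends only on the number of edges and
the number of pairs with no common neighbour. -/
theorem TwoStepConnected.of_codegreeSum_eq [Fintype V] [Fintype W] {G : SimpleGraph V}
    {H : SimpleGraph W} (hG : G.TwoStepConnected) (hGt : G.NoTriangle) (hHt : H.NoTriangle)
    (hm : G.edgeSet.ncard = H.edgeSet.ncard) (h : ∀ t, G.codegreeSum t = H.codegreeSum t) :
    H.TwoStepConnected := by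
  classical
  have hGs := G.alternating_sum_codegreeSum (N := G.edgeSet.ncard) (by omega)
  have hHs := H.alternating_sum_codegreeSum (N := G.edgeSet.ncard) (by omega)
  rw [Finset.sum_congr rfl fun t _ => by rw [h t], hHs] at hGs
  have hGf : ((Finset.univ : Finset V).offDiag.filter
      fun p => (G.commonNeighbors p.1 p.2).ncard = 0) =
      (Finset.univ : Finset (V × V)).filter fun p => G.Adj p.1 p.2 := by
    ext ⟨x, y⟩
    simp only [Finset.mem_filter, Finset.mem_offDiag, Finset.mem_univ, true_and, ne_eq,
      ncard_commonNeighbors_eq_zero]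
    constructor
    · rintro ⟨hne, hno⟩
      by_contra hadj
      obtain ⟨z, hz⟩ := hG hne hadj
      exact hno z hz
    · exact fun hadj => ⟨hadj.ne, fun z hz => hGt hadj hz.1 hz.2⟩
  have hHsub : ((Finset.univ : Finset (W × W)).filter fun p => H.Adj p.1 p.2) ⊆
      ((Finset.univ : Finset W).offDiag.filter
        fun p => (H.commonNeighbors p.1 p.2).ncard = 0) := by
    rintro ⟨x, y⟩
    simp only [Finset.mem_filter, Finset.mem_offDiag, Finset.mem_univ, true_and, ne_eq,
      ncard_commonNeighbors_eq_zero]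
    exact fun hadj => ⟨hadj.ne, fun z hz => hHt hadj hz.1 hz.2⟩
  have heq := Finset.eq_of_subset_of_card_le hHsub (by
    rw [card_filter_adj, ← hm, ← card_filter_adj, ← hGf]
    exact_mod_cast hGs.le)
  intro x y hne hadj
  by_contra hno
  have hxy : (x, y) ∈ ((Finset.univ : Finset W).offDiag.filter
      fun p => (H.commonNeighbors p.1 p.2).ncard = 0) := by
    simp only [Finset.mem_filter, Finset.mem_offDiag, Finset.mem_univ, true_and, ne_eq,
      ncard_commonNeighbors_eq_zero]
    exact ⟨hne, fun z hz => hno ⟨z, hz⟩⟩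
  rw [← heq] at hxy
  exact hadj (by simpa using hxy)

/-! ### Replacing one edge -/

theorem adj_iff_of_deleteEdges_eq {G H : SimpleGraph V} {e f : Sym2 V} (hf : f ∈ H.edgeSet)
    (h : G.deleteEdges {e} = H.deleteEdges {f}) (x y : V) :
    H.Adj x y ↔ (G.Adj x y ∧ s(x, y) ≠ e) ∨ s(x, y) = f := by
  have hxy : (G.deleteEdges {e}).Adj x y ↔ (H.deleteEdges {f}).Adj x y := by rw [h]
  simp only [deleteEdges_adj, Set.mem_singleton_iff] at hxy
  by_cases hc : s(x, y) = f
  · have : H.Adj x y := by rwa [← mem_edgeSet, hc]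
    simp [hc, this]
  · simp only [hc, or_false, ne_eq]
    tauto

theorem eq_of_deleteEdges_eq {G H : SimpleGraph V} {e : Sym2 V} (he : e ∈ G.edgeSet)
    (hf : e ∈ H.edgeSet) (h : G.deleteEdges {e} = H.deleteEdges {e}) : H = G := by
  ext x y
  rw [adj_iff_of_deleteEdges_eq hf h]
  by_cases hc : s(x, y) = e
  · have : G.Adj x y := by rwa [← mem_edgeSet, hc]
    simp [hc, this]
  · simp [hc]

/-- Replacing an edge of a two-step connected graph by another one, without creating a triangle,
slides one end of the edge along an adjacent edge. -/
theorem TwoStepConnected.exists_slide {G H : SimpleGraph V} (hG : G.TwoStepConnected)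
    (hH : H.NoTriangle) {e f : Sym2 V} (he : e ∈ G.edgeSet) (hf : f ∈ H.edgeSet)
    (h : G.deleteEdges {e} = H.deleteEdges {f}) (hne : H ≠ G) :
    ∃ u v w, e = s(u, v) ∧ f = s(u, w) ∧ u ≠ w ∧ G.Adj u v ∧ G.Adj v w ∧
      ∀ z, G.Adj u z → G.Adj w z → z = v := by
  have hef : e ≠ f := by
    rintro rfl
    exact hne (eq_of_deleteEdges_eq he hf h)
  have hadj := adj_iff_of_deleteEdges_eq hf h
  have hadj' := adj_iff_of_deleteEdges_eq he h.symm
  induction f with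
  | _ a b =>
    have hab : a ≠ b := H.ne_of_adj hf
    have hGab : ¬ G.Adj a b := by
      rw [hadj']
      rintro (h' | h')
      · exact h'.2 rfl
      · exact hef h'.symm
    -- A common neighbour of `a` and `b` closes a triangle with the new edge unless `e` was one of
    -- its two links.
    have hthrough : ∀ z, G.Adj a z → G.Adj b z → e = s(a, z) ∨ e = s(b, z) := by
      intro z haz hbz
      by_contra! hcon
      exact hH hf ((hadj a z).2 (Or.inl ⟨haz, hcon.1.symm⟩))
        ((hadj b z).2 (Or.inl ⟨hbz, hcon.2.symm⟩))
    obtain ⟨z, haz, hbz⟩ := hG hab hGab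
    rcases hthrough z haz hbz with rfl | rfl
    · refine ⟨a, z, b, rfl, rfl, hab, haz, hbz.symm, fun z' h1 h2 => ?_⟩
      have := hthrough z' h1 h2
      rw [Sym2.eq_iff, Sym2.eq_iff] at this
      clear hadj hadj' hthrough
      grind
    · refine ⟨b, z, a, rfl, Sym2.eq_swap, hab.symm, hbz, haz.symm, fun z' h1 h2 => ?_⟩
      have := hthrough z' h2 h1
      rw [Sym2.eq_iff, Sym2.eq_iff] at this
      clear hadj hadj' hthrough
      grind

/-- If the common neighbours of two vertices account for all the (at least four) edges, then some
edge-card determines the graph among triangle-free two-step connected graphs. -/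
theorem exists_edge_forall_eq [Finite V] {G : SimpleGraph V} (hE : 4 ≤ G.edgeSet.ncard) {x y : V}
    (hxy : x ≠ y) (hm : 2 * (G.commonNeighbors x y).ncard = G.edgeSet.ncard) :
    ∃ e ∈ G.edgeSet, ∀ (H : SimpleGraph V) (f : Sym2 V), f ∈ H.edgeSet →
      G.deleteEdges {e} = H.deleteEdges {f} → H.NoTriangle →
      (G.TwoStepConnected ∨ H.TwoStepConnected) → H = G := by
  obtain ⟨s, hs, s', hs', hss⟩ := (Set.one_lt_ncard (Set.toFinite _)).1
    (by omega : 1 < (G.commonNeighbors x y).ncard)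
  rw [mem_commonNeighbors] at hs hs'
  have hspan := fun a b => exists_commonNeighbor_of_mem_edgeSet hxy hm (a := a) (b := b)
  simp only [Sym2.eq_iff] at hspan
  have hxs := hs.1.ne
  have hys := hs.2.ne
  refine ⟨s(x, s), hs.1, fun H f hf h hH hor => ?_⟩
  have hadj := adj_iff_of_deleteEdges_eq hf h
  by_contra hne
  have hef : s(x, s) ≠ f := by
    rintro rfl
    exact hne (eq_of_deleteEdges_eq hs.1 hf h)
  have hHxs' : H.Adj x s' := (hadj _ _).2 (Or.inl ⟨hs'.1, by simp [Ne.symm hss, hxs]⟩)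
  have hHy : ∀ z, G.Adj y z → H.Adj y z := fun z hz => (hadj _ _).2 (Or.inl ⟨hz, by
    simp only [ne_eq, Sym2.eq_iff, Ne.symm hxy, hys, false_and, or_false, not_false_eq_true]⟩)
  -- If `G` is two-step connected, the replacement is a slide, but its two ends `u`, `w` have a
  -- second common neighbour (`s'` or `y`). If `H` is, then `x` and `s` are joined in `H` through
  -- some `z`; the new edge must be `sz`, and `s`, `z`, `y` form a triangle.
  rcases hor with hG | hH2
  · obtain ⟨u, v, w, he, -, huw, huv, hvw, huniq⟩ := hG.exists_slide hH hs.1 hf h hne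
    rw [Sym2.eq_iff] at he
    rcases he with ⟨rfl, rfl⟩ | ⟨rfl, rfl⟩
    · obtain ⟨z, hz1, hz2, hz⟩ := hspan _ _ hvw
      have hwy : w = y := by have := hz1.ne; have := hz2.ne; clear hadj hspan; grind
      subst hwy
      exact hss (huniq _ hs'.1 hs'.2).symm
    · obtain ⟨z, hz1, hz2, hz⟩ := hspan _ _ hvw
      have hzw : G.Adj w y := by
        have : w = z := by have := hz1.ne; have := hz2.ne; clear hadj hspan; grind
        exact this ▸ hz2.symm
      exact hxy (huniq y hs.2.symm hzw).symm
  · have hHxs : ¬ H.Adj x s := by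
      rw [hadj]
      rintro (h' | h')
      · exact h'.2 rfl
      · exact hef h'
    have hHxy : ¬ H.Adj x y := fun h' => hH h' hHxs' (hHy _ hs'.2)
    obtain ⟨z, h1, h2⟩ := hH2 hxs hHxs
    have hzy : z ≠ y := by rintro rfl; exact hHxy h1
    have hsz : ¬ (G.Adj s z ∧ s(s, z) ≠ s(x, s)) := by
      rintro ⟨h3, h4⟩
      obtain ⟨z', hz1, hz2, hz⟩ := hspan _ _ h3
      have := hz1.ne
      have := hz2.ne
      rw [ne_eq, Sym2.eq_iff] at h4
      clear hadj hspan
      grind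
    have hsf := ((hadj s z).1 h2).resolve_left hsz
    have hxz : G.Adj x z := by
      rcases (hadj x z).1 h1 with h3 | h3
      · exact h3.1
      · have := hsf.trans h3.symm
        rw [Sym2.eq_iff] at this
        have := h1.ne
        clear hadj hspan
        grind
    obtain ⟨z', hz1, hz2, hz⟩ := hspan _ _ hxz
    have hyz : G.Adj y z := by
      have := hz1.ne
      clear hadj hspan
      grind
    exact hH h2 (hHy _ hs.2).symm (hHy _ hyz).symm

/-! ### Slides and the degree contradiction -/

/-- The edge `uv` may be replaced by `uw` keeping the graph triangle-free and two-step connected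
and the sum of the squares of the degrees unchanged. -/
structure Slides (G : SimpleGraph V) (u v w : V) : Prop where
  ne : u ≠ w
  adj_left : G.Adj u v
  adj_right : G.Adj v w
  unique : ∀ z, G.Adj u z → G.Adj w z → z = v
  -- Removing `uv` destroys the paths `v u z` and `u v z`; `fixed` and `moved` supply replacements.
  fixed : ∀ z, G.Adj u z → z ≠ v → ∃ y, y ≠ u ∧ G.Adj v y ∧ G.Adj z y
  moved : ∀ z, G.Adj v z → z ≠ u → z ≠ w → ∃ y, y ≠ v ∧ G.Adj u y ∧ G.Adj z y
  degree : (G.neighborSet v).ncard = (G.neighborSet w).ncard + 1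

/-- Moving one unit from `v` to `w` changes the sum of squares by `2 * (d w - d v + 1)`. -/
theorem eq_add_one_of_sum_sq_eq [Fintype V] {d d' : V → ℕ} {v w : V} (hvw : v ≠ w)
    (h : ∀ z, z ≠ v → z ≠ w → d' z = d z) (hv : d v = d' v + 1) (hw : d' w = d w + 1)
    (hsum : ∑ z, d z ^ 2 = ∑ z, d' z ^ 2) : d v = d w + 1 := by
  classical
  have hmem : w ∈ Finset.univ.erase v := by simp [hvw.symm]
  rw [← Finset.add_sum_erase _ _ (Finset.mem_univ v), ← Finset.add_sum_erase _ _ hmem,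
    ← Finset.add_sum_erase _ (fun z => d' z ^ 2) (Finset.mem_univ v),
    ← Finset.add_sum_erase _ (fun z => d' z ^ 2) hmem,
    Finset.sum_congr rfl fun z hz => by
      rw [← h z (Finset.ne_of_mem_erase (Finset.mem_of_mem_erase hz)) (Finset.ne_of_mem_erase hz)],
    hv, hw] at hsum
  rw [hv]
  nlinarith

theorem slides_of_replace [Fintype V] {G H : SimpleGraph V} (hG : G.TwoStepConnected)
    (hGt : G.NoTriangle) (hH : H.TwoStepConnected) (hHt : H.NoTriangle)
    (hsum : ∑ z, (G.neighborSet z).ncard ^ 2 = ∑ z, (H.neighborSet z).ncard ^ 2)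
    {e f : Sym2 V} (he : e ∈ G.edgeSet) (hf : f ∈ H.edgeSet)
    (h : G.deleteEdges {e} = H.deleteEdges {f}) (hne : H ≠ G) :
    ∃ u v w, e = s(u, v) ∧ G.Slides u v w := by
  obtain ⟨u, v, w, rfl, rfl, huw, huv, hvw, huniq⟩ := hG.exists_slide hHt he hf h hne
  have hadj := adj_iff_of_deleteEdges_eq hf h
  simp only [ne_eq, Sym2.eq_iff] at hadj
  have huv' := huv.ne
  have hvw' := hvw.ne
  have hGuw : ¬ G.Adj u w := fun h' => hGt huv h' hvw
  refine ⟨u, v, w, rfl, huw, huv, hvw, huniq, ?_, ?_, ?_⟩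
  · intro z huz hz
    have hvz : ¬ H.Adj v z := by
      rw [hadj]
      rintro (h' | h')
      · exact hGt huv huz h'.1
      · clear hadj hsum h; grind
    obtain ⟨y, h1, h2⟩ := hH hz.symm hvz
    have := huz.ne
    rw [hadj] at h1 h2
    clear hadj hsum h
    exact ⟨y, by grind, by grind, by grind⟩
  · intro z hvz hzu hzw
    have huz : ¬ H.Adj u z := by
      rw [hadj]
      rintro (h' | h')
      · exact hGt huv h'.1 hvz
      · clear hadj hsum h; grind
    obtain ⟨y, h1, h2⟩ := hH hzu.symm huz
    have hyw : y ≠ w := by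
      rintro rfl
      rw [hadj] at h2
      rcases h2 with h2 | h2
      · exact hGt hvz hvw h2.1
      · clear hadj hsum h; grind
    rw [hadj] at h1 h2
    clear hadj hsum h
    exact ⟨y, by grind, by grind, by grind⟩
  · have hNu : H.neighborSet u = insert w (G.neighborSet u \ {v}) := by
      ext z; simp only [mem_neighborSet, hadj, Set.mem_insert_iff, Set.mem_sdiff,
        Set.mem_singleton_iff]; clear hadj hsum h; grind
    have hNv : H.neighborSet v = G.neighborSet v \ {u} := by
      ext z; simp only [mem_neighborSet, hadj, Set.mem_sdiff, Set.mem_singleton_iff]; clear hadj hsum h; grind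
    have hNw : H.neighborSet w = insert u (G.neighborSet w) := by
      ext z; simp only [mem_neighborSet, hadj, Set.mem_insert_iff]; clear hadj hsum h; grind
    refine eq_add_one_of_sum_sq_eq (d' := fun z => (H.neighborSet z).ncard) hvw' ?_ ?_ ?_ hsum
    · intro z hzv hzw
      by_cases hzu : z = u
      · subst hzu
        rw [hNu, Set.ncard_insert_of_notMem (by simp [hGuw]),
          Set.ncard_sdiff_singleton_add_one (by simpa using huv)]
      · congr 1
        ext y; simp only [mem_neighborSet, hadj]; clear hadj hsum h; grind
    · simp only [hNv]
      exact (Set.ncard_sdiff_singleton_add_one (by simpa using huv.symm)).symm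
    · simp only [hNw]
      exact Set.ncard_insert_of_notMem (by simpa [adj_comm] using hGuw)

/-- The edge `vw` slides as well. Any slide other than `wv` to `wu` would need a second common
neighbour of `u` and `w`, against `unique`; that slide gives the degree relation. -/
theorem Slides.degree_left {G : SimpleGraph V} {u v w : V} (h : G.Slides u v w)
    (hall : ∀ e ∈ G.edgeSet, ∃ u v w, e = s(u, v) ∧ G.Slides u v w) :
    (G.neighborSet v).ncard = (G.neighborSet u).ncard + 1 := by
  obtain ⟨u', v', w', he, h'⟩ := hall s(v, w) h.adj_right
  rw [Sym2.eq_iff] at he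
  rcases he with ⟨rfl, rfl⟩ | ⟨rfl, rfl⟩
  · obtain ⟨y, hy, h1, h2⟩ := h'.fixed u h.adj_left.symm h.ne
    exact (hy (h.unique y h2 h1)).elim
  · by_cases hw : u = w'
    · exact hw ▸ h'.degree
    · obtain ⟨y, hy, h1, h2⟩ := h'.moved u h.adj_left.symm h.ne hw
      exact (hy (h.unique y h2 h1)).elim

theorem not_forall_slides [Finite V] {G : SimpleGraph V} (hG : G.TwoStepConnected)
    (hE : 4 ≤ G.edgeSet.ncard) :
    ¬ ∀ e ∈ G.edgeSet, ∃ u v w, e = s(u, v) ∧ G.Slides u v w := by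
  classical
  have := Fintype.ofFinite V
  intro hall
  set d : V → ℕ := fun z => (G.neighborSet z).ncard with hd
  have hdeg : ∀ a b, G.Adj a b → d a = d b + 1 ∨ d b = d a + 1 := by
    intro a b hab
    obtain ⟨u, v, w, he, h⟩ := hall s(a, b) hab
    have h1 : d v = d u + 1 := h.degree_left hall
    rw [Sym2.eq_iff] at he
    rcases he with ⟨rfl, rfl⟩ | ⟨rfl, rfl⟩ <;> omega
  obtain ⟨e, he⟩ : G.edgeSet.Nonempty := Set.nonempty_of_ncard_ne_zero (by omega)
  obtain ⟨u, v, w, rfl, h⟩ := hall e he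
  have hu : d v = d u + 1 := h.degree_left hall
  have hw : d v = d w + 1 := h.degree
  -- Degree parity alternates along edges. Another neighbour `z` of `u` would reach `w` through some
  -- `y`, closing the odd cycle `u z y w v`.
  have hNu : ∀ z, G.Adj u z → z = v := by
    by_contra! hcon
    obtain ⟨z, huz, hzv⟩ := hcon
    have hwz : ¬ G.Adj w z := fun h' => hzv (h.unique z huz h')
    have hne : w ≠ z := by
      rintro rfl
      have := hdeg _ _ huz
      omega
    obtain ⟨y, h1, h2⟩ := hG hne hwz
    have := hdeg _ _ huz
    have := hdeg _ _ h1
    have := hdeg _ _ h2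
    omega
  have hdu : d u = 1 := by
    have : G.neighborSet u = {v} := by
      ext z
      exact ⟨fun hz => hNu z hz, fun hz => hz ▸ h.adj_left⟩
    simp [hd, this]
  have huniv : (Set.univ : Set V) ⊆ insert v (G.neighborSet v) := by
    intro x _
    by_cases hxu : x = u
    · exact Or.inr (hxu ▸ h.adj_left.symm)
    · by_cases hux : G.Adj u x
      · exact Or.inl (hNu x hux)
      · obtain ⟨y, h1, h2⟩ := hG (Ne.symm hxu) hux
        exact Or.inr ((hNu y h1) ▸ h2.symm)
  have hcard : Fintype.card V ≤ 3 := by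
    have h1 := Set.ncard_le_ncard huniv
    have h2 := Set.ncard_insert_le v (G.neighborSet v)
    rw [Set.ncard_univ, Nat.card_eq_fintype_card] at h1
    have : (G.neighborSet v).ncard = d v := rfl
    omega
  have hle : G.edgeFinset.card ≤ _ := G.card_edgeFinset_le_card_choose_two
  have h3 : (Fintype.card V).choose 2 ≤ (3).choose 2 := Nat.choose_le_choose 2 hcard
  have hE' : G.edgeSet.ncard = G.edgeFinset.card := by
    rw [Set.ncard_eq_toFinset_card']; rfl
  have h4 : Nat.choose 3 2 = 3 := rfl
  omega

end SimpleGraph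

theorem theorem6 {V : Type u} [Finite V] (G : SimpleGraph V)
    (hE : 4 ≤ G.edgeSet.ncard) (hdiam : G.diam = 2) (htri : G.CliqueFree 3) :
    SimpleGraph.EdgeReconstructible.{u, v} G := by
  classical
  intro W _ H hdeck
  have := Fintype.ofFinite V
  have := Fintype.ofFinite W
  have hG := SimpleGraph.twoStepConnected_of_diam hdiam
  have hGt := htri.noTriangle
  have hHt := hdeck.noTriangle hE hGt
  have hm := hdeck.ncard_edgeSet
  by_cases hGpair : ∃ x y, x ≠ y ∧ 2 * (G.commonNeighbors x y).ncard = G.edgeSet.ncard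
  · obtain ⟨x, y, hxy, h⟩ := hGpair
    obtain ⟨e, he, hforce⟩ := SimpleGraph.exists_edge_forall_eq hE hxy h
    obtain ⟨H', ⟨φ⟩, f, hf, heq⟩ := hdeck.exists_replace he
    obtain rfl := hforce H' f hf heq (φ.symm.noTriangle hHt) (Or.inl hG)
    exact ⟨φ⟩
  by_cases hHpair : ∃ x y, x ≠ y ∧ 2 * (H.commonNeighbors x y).ncard = H.edgeSet.ncard
  · obtain ⟨x, y, hxy, h⟩ := hHpair
    obtain ⟨e, he, hforce⟩ := SimpleGraph.exists_edge_forall_eq (hm ▸ hE) hxy h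
    obtain ⟨G', ⟨φ⟩, f, hf, heq⟩ := hdeck.symm.exists_replace he
    -- The roles are exchanged: only the replaced graph `G'` is known to be two-step connected.
    obtain rfl := hforce G' f hf heq (φ.symm.noTriangle hGt) (Or.inr (φ.symm.twoStepConnected hG))
    exact ⟨φ.symm⟩
  push Not at hGpair hHpair
  have hsum : ∀ t, G.codegreeSum t = H.codegreeSum t := by
    intro t
    by_cases ht : 2 * t < G.edgeSet.ncard
    · exact hdeck.codegreeSum_eq ht
    -- With the extremal pairs excluded, such a `t` exceeds every codegree in both graphs.
    · rw [SimpleGraph.codegreeSum_eq_zero, SimpleGraph.codegreeSum_eq_zero]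
      · intro x y hxy
        have := H.two_mul_ncard_commonNeighbors_le hxy
        have := hHpair x y hxy
        omega
      · intro x y hxy
        have := G.two_mul_ncard_commonNeighbors_le hxy
        have := hGpair x y hxy
        omega
  have hH := hG.of_codegreeSum_eq hGt hHt hm hsum
  by_contra hiso
  refine SimpleGraph.not_forall_slides hG hE fun e he => ?_
  obtain ⟨H', ⟨φ⟩, f, hf, heq⟩ := hdeck.exists_replace he
  refine SimpleGraph.slides_of_replace hG hGt (φ.symm.twoStepConnected hH)
    (φ.symm.noTriangle hHt) ?_ he hf heq ?_
  · have hm' : H'.edgeSet.ncard = H.edgeSet.ncard := Nat.card_congr φ.mapEdgeSet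
    rw [SimpleGraph.sum_sq_ncard_neighborSet, SimpleGraph.sum_sq_ncard_neighborSet,
      φ.codegreeSum_eq, hsum, hm, hm']
  · rintro rfl
    exact hiso ⟨φ⟩
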